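/- Conventions. $S_m$ and $A_m$ ($m\ge 1$) are the symmetric and alternating groups on $m$ points; $\mathrm{Sym}$ and $\mathrm{Alt}$ are the classes of all $S_m$, respectively all $A_m$, up to isomorphism. For a group $H$, $X\subseteq H$ and $n\in\mathbb N$, let $C_n(X,H)$ be the set of products $x_1^{g_1}\cdots x_n^{g_n}$ with $g_i\in H$, $x_i\in X$ or $x_i^{-1}\in X$, where $x^g=g^{-1}xg$. A set $Y\subseteq H$ is $n$-separated from $X$ if $Y\cap C_n(X,H)=\emptyset$. For a class $\mathcal K$ of groups, a group $G$ is $\mathcal K$-approximable if for every finite $\Phi\subseteq G$ and every $n\in\mathbb N$ there are $H\in\mathcal K$ and a map $\phi:\Phi\to H$ such that $\phi(1)=1$ (if $1\in\Phi$) and $\phi(\Phi\setminus\{1\})$ is $n$-separated from $\{\phi(g)\phi(h)\phi(gh)^{-1} : g,h,gh\in\Phi\}$. For $h\in S_m$ let $\|h\|$ be the number of points moved by $h$, divided by $m$. A group $G$ is sofic if there is a function $\alpha:G\to\mathbb R$ with $\alpha_1=0$ and $\alpha_g>0$ for $g\ne1$ such that for every finite $\Phi\subseteq G$ and every $\varepsilon>0$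 there are $m\ge1$ and a map $\phi:\Phi\to S_m$ such that $\phi(1)=1$ (if $1\in\Phi$), $\|\phi(g)\|\ge\alpha_g$ for all $g\in\Phi$, and $\|\phi(gh)(\phi(g)\phi(h))^{-1}\|<\varepsilon$ whenever $g,h,gh\in\Phi$. Theorem. (1) Let $\mathcal K=\mathrm{Alt}$ or $\mathcal K=\mathrm{Sym}$. For every index set $I$ and all groups $H_i\in\mathcal K$ ($i\in I$), every quotient of the unrestricted direct product $\prod_{i\in I}H_i$ by a normal subgroup (not necessarily closed) is $\mathcal K$-approximable, and it is sofic. (2) Let $\mathcal K=\mathrm{Alt}$, $\mathcal K=\mathrm{Sym}$ or $\mathcal K=\mathrm{Alt}\cup\mathrm{Sym}$. A group is sofic if and only if it is isomorphic to a subgroup of a quotient of an unrestricted direct product $\prod_{i\in I}H_i$ of groups from $\mathcal K$, for some index set $I$. For a countable group one may take $I=\mathbb N$: a countable group is sofic if and only if it is isomorphic to a subgroup of a quotient of $\prod_{i\in\mathbb N}H_i$ for some $H_i\in\mathcal K$. -/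

import Mathlib

universe u v

/-- An invariant (pseudo) length function on a group. -/
structure InvariantLength (G : Type*) [Group G] where
  toFun : G → ℝ
  nonneg : ∀ g, 0 ≤ toFun g
  map_one : toFun 1 = 0
  map_mul_le : ∀ g h, toFun (g * h) ≤ toFun g + toFun h
  map_conj : ∀ g h, toFun (h⁻¹ * g * h) = toFun g

/-- A group `G` is `(K, L)`-approximable, where `K` is a class of groups and `L H` is the set of
admissible invariant length functions on `H`. Maps defined on the finite set `Φ` are represented by
maps defined on all of `G`; only their values on `Φ` (and at `1`) matter. -/
def MetricApproximable (K : Set GrpCat.{0}) (L : ∀ H : GrpCat.{0}, Set (InvariantLength H))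
    (G : Type*) [Group G] : Prop :=
  ∃ α : G → ℝ, α 1 = 0 ∧ (∀ g, g ≠ 1 → 0 < α g) ∧
    ∀ (Φ : Finset G) (ε : ℝ), 0 < ε →
      ∃ H ∈ K, ∃ l ∈ L H, ∃ φ : G → H,
        φ 1 = 1 ∧
        (∀ g ∈ Φ, α g ≤ l.toFun (φ g)) ∧
        (∀ g ∈ Φ, ∀ h ∈ Φ, g * h ∈ Φ → l.toFun (φ (g * h) * (φ g * φ h)⁻¹) < ε)

/-- The set `C_n(X, G)` of `n`-consequences of `X` in `G`: products of exactly `n` conjugates of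
elements of `X` and their inverses. -/
def consequences {G : Type*} [Group G] (n : ℕ) (X : Set G) : Set G :=
  {y | ∃ x g : Fin n → G, (∀ i, x i ∈ X ∨ (x i)⁻¹ ∈ X) ∧
    y = (List.ofFn fun i => (g i)⁻¹ * x i * g i).prod}

/-- `Y` is `n`-separated from `X` in `G`. -/
def NSeparated {G : Type*} [Group G] (n : ℕ) (Y X : Set G) : Prop :=
  Y ∩ consequences n X = ∅

/-- A group `G` is `K`-approximable, where `K` is a class of groups. -/
def Approximable (K : Set GrpCat.{0}) (G : Type*) [Group G] : Prop :=
  ∀ (Φ : Finset G) (n : ℕ), ∃ H ∈ K, ∃ φ : G → H,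
    φ 1 = 1 ∧
    NSeparated n {y | ∃ g ∈ Φ, g ≠ 1 ∧ y = φ g}
      {x | ∃ g ∈ Φ, ∃ h ∈ Φ, g * h ∈ Φ ∧ x = φ g * φ h * (φ (g * h))⁻¹}

/-- The class of finite symmetric groups `S_m`, `m ≥ 1` (up to isomorphism). -/
def SymClass : Set GrpCat.{0} :=
  {H | ∃ m : ℕ, 1 ≤ m ∧ Nonempty (H ≃* Equiv.Perm (Fin m))}

/-- The class of finite alternating groups `A_m`, `m ≥ 1` (up to isomorphism). -/
def AltClass : Set GrpCat.{0} :=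
  {H | ∃ m : ℕ, 1 ≤ m ∧ Nonempty (H ≃* alternatingGroup (Fin m))}

/-- The normalized Hamming length of a permutation: the proportion of points that it moves. -/
noncomputable def hammingLength {m : ℕ} (h : Equiv.Perm (Fin m)) : ℝ :=
  (h.support.card : ℝ) / m

/-- The normalized Hamming length functions on a group `H` that is isomorphic to some `S_m`. -/
def hammingLengths (H : GrpCat.{0}) : Set (InvariantLength H) :=
  {l | ∃ m : ℕ, 1 ≤ m ∧ ∃ e : H ≃* Equiv.Perm (Fin m), ∀ h, l.toFun h = hammingLength (e h)}

/-- Sofic groups: `(Sym, Hamming)`-approximable groups. -/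
def Sofic (G : Type*) [Group G] : Prop :=
  MetricApproximable SymClass hammingLengths G

/-- `G` is isomorphic to a subgroup of a quotient of an unrestricted direct product, indexed by
`I`, of groups from `K`. -/
def SubgroupOfQuotientOfProduct (K : Set GrpCat.{0}) (I : Type*) (G : Type*) [Group G] : Prop :=
  ∃ H : I → GrpCat.{0}, (∀ i, H i ∈ K) ∧
    ∃ (N : Subgroup (∀ i, H i)) (_ : N.Normal) (f : G →* (∀ i, H i) ⧸ N), Function.Injective f

/-!
A quotient of a product of finite alternating or symmetric groups is sofic, and conversely a sofic
group embeds in such a quotient by the families of its approximations, taken modulo families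
whose Hamming length tends to zero (`SoficVia.subgroupOfQuotient`). A Hamming
approximation is also `n`-separated once its defect is small compared with `1 / n`, because a
product of `n` conjugates of elements of length at most `δ` has length at most `n * δ`
(`SoficVia.approximable`). Alternating groups may replace symmetric ones, since letting a
permutation act on two copies of its set makes it even and preserves its length.

The substance is that `P ⧸ N` is sofic for `P = ∏ i, H i` and an arbitrary normal subgroup `N`.
The approximations are obtained from homomorphisms `ρ` from finitely generated subgroups of `P` to
finite symmetric groups: for `g ∉ N`, a finite set `X ⊆ N` and `ε > 0`, one needs `ρ g` to move at
least a fixed proportion of the points, and `ρ x` to move less than a proportion `ε` of them for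
all `x ∈ X` (`exists_separating_rep`). Finitely many such `ρ` are combined by the action on the
product of the underlying sets, where the proportions of fixed points multiply.

To find `ρ`, let `K ≤ P` consist of the elements whose `i`-th coordinate is even if `H i` is `A_m`
or `S_m` with `m ≥ 5`, and trivial if `m ≤ 4`.

* If `g ∉ N K`, use that `P / K` embeds in a power of a finite group, so that it is locally
  finite. The image of a finitely generated subgroup of `P` in `P / N K` is finite, and its regular
  representation serves (`exists_rep_of_notMem`).
* If `g ∈ N K`, one may replace `g` by an element `d ∈ K`. For each constant `C` there is a
  coordinate `i` in which `d i ≠ 1` and the support of `d i` is at least `C` times as large as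
  that of `x i` for every `x ∈ X`. Otherwise, a uniform bound (`exists_uniform_commConj_pow`)
  would write each `d i` as a product of boundedly many conjugates of commutators `[x i, h]` with
  `h` even. Unlike the `x i` themselves, these can be switched off coordinate by coordinate, by
  taking `h = 1`, and they assemble to elements of `N`; so `d ∈ N`, a contradiction
  (`mem_of_forall_support_le`). In such a coordinate `H i` acts on `k`-tuples of points, where `k`
  is about the inverse of the length of `d i`; this makes `d i` long and keeps all `x i` short
  (`exists_amplification`).

The uniform bound says that if `m ≥ 5`, `g ∈ A_m` and `|supp g| ≤ C |supp x|`, then `g` is a product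
of `T` conjugates of commutators of `x` with even permutations, where `T` depends on `C` only. If
the support of `x` is large, commutators of `x` with involutions include involutions whose
support is comparable with that of `x`, and every `g` is a product of two involutions, which are
cut into pieces of that size. If the support of `x` is small and `m` is large, `x` has fixed
points and its commutators include all 3-cycles. In the finitely many remaining cases, the bound
follows from the simplicity of `A_m`.
-/

open Equiv Equiv.Perm Filter
open scoped Pointwise Topology

/-! ### Involutions in finite symmetric groups -/

section Combinatorics

variable {α : Type*}

/-- Every permutation `g = a * (a * g)` is a product of two involutions that fix all fixed points of
`g`. In each cycle of `g` choose a base point `r`; then `a` is the reflection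
`g ^ i r ↦ g ^ (-i) r`, which inverts `g`. -/
theorem exists_involution_mul_involution (g : Perm α) :
    ∃ a : Perm α, a * a = 1 ∧ (a * g) * (a * g) = 1 ∧ ∀ y, g y = y → a y = y := by
  classical
  let rep : α → α := fun y => (Quotient.mk (SameCycle.setoid g) y).out
  have hrep : ∀ y, ∃ i : ℤ, (g ^ i) (rep y) = y := fun y =>
    Quotient.exact (Quotient.out_eq (Quotient.mk (SameCycle.setoid g) y))
  choose i hi using hrep
  have rep_eq : ∀ (y : α) (j : ℤ), rep ((g ^ j) y) = rep y := by
    intro y j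
    have : Quotient.mk (SameCycle.setoid g) ((g ^ j) y) = Quotient.mk (SameCycle.setoid g) y :=
      Quotient.sound (SameCycle.symm ⟨j, rfl⟩)
    simp only [rep, this]
  let f : α → α := fun y => (g ^ (-i y)) (rep y)
  -- The value of `f` does not depend on the exponent, which is determined only modulo the length of
  -- the cycle.
  have key : ∀ (y : α) (j : ℤ), (g ^ j) (rep y) = y → f y = (g ^ (-j)) (rep y) := by
    intro y j hj
    have h1 : (g ^ i y) (rep y) = (g ^ j) (rep y) := (hi y).trans hj.symm
    calc f y = (g ^ (-i y - j)) ((g ^ j) (rep y)) := by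
          rw [← Perm.mul_apply, ← zpow_add]; simp [f]
      _ = (g ^ (-i y - j)) ((g ^ i y) (rep y)) := by rw [h1]
      _ = (g ^ (-j)) (rep y) := by
          rw [← Perm.mul_apply, ← zpow_add]; congr 2; ring
  have rep_f : ∀ y, rep (f y) = rep y := by
    intro y
    have h1 : f y = (g ^ (-i y - i y)) y := by
      conv_rhs => rw [← hi y]
      rw [← Perm.mul_apply, ← zpow_add, hi y]; simp [f]
    rw [h1, rep_eq]
  have hff : ∀ y, f (f y) = y := by
    intro y
    have := key (f y) (-i y) (by rw [rep_f])
    rw [this, rep_f, neg_neg, hi]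
  have hfg : ∀ y, f (g y) = g⁻¹ (f y) := by
    intro y
    have hr : rep (g y) = rep y := by simpa using rep_eq y 1
    have := key (g y) (1 + i y) (by rw [hr, zpow_add, Perm.mul_apply, hi]; simp)
    rw [this, hr]
    change _ = g⁻¹ ((g ^ (-i y)) (rep y))
    rw [neg_add, zpow_add, Perm.mul_apply]; simp
  refine ⟨⟨f, f, hff, hff⟩, ?_, ?_, ?_⟩
  · ext y; exact hff y
  · ext y
    change f (g (f (g y))) = y
    rw [hfg y, ← Perm.mul_apply, mul_inv_cancel, Perm.one_apply, hff]
  · intro y hy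
    change f y = y
    have h1 : ∀ j : ℤ, (g ^ j) y = y := fun j => zpow_apply_eq_self_of_apply_eq_self hy j
    have h2 : rep y = y := by
      have := hi y
      have h3 := congrArg (g ^ (-i y)) this
      rw [h1, ← Perm.mul_apply, ← zpow_add] at h3
      simpa using h3
    change (g ^ (-i y)) (rep y) = y
    rw [h2, h1]

theorem mul_self_of_disjoint {a b : Perm α} (h : Perm.Disjoint a b) (ha : a * a = 1)
    (hb : b * b = 1) : (a * b) * (a * b) = 1 := by
  rw [h.commute.symm.mul_mul_mul_comm, ha, hb, one_mul]

variable [Fintype α] [DecidableEq α]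

theorem exists_swap_mul_of_involution {a : Perm α} (ha : a * a = 1) (h1 : a ≠ 1) :
    ∃ s b : Perm α, a = s * b ∧ s.IsSwap ∧ Perm.Disjoint s b ∧ b * b = 1 := by
  obtain ⟨x, hx⟩ : ∃ x, a x ≠ x := by
    by_contra! h
    exact h1 (Perm.ext h)
  have haa : ∀ y, a (a y) = y := fun y => by rw [← Perm.mul_apply, ha, Perm.one_apply]
  have hainv : a⁻¹ = a := inv_eq_of_mul_eq_one_left ha
  have hcomm : a * swap x (a x) = swap x (a x) * a := by
    have := mul_swap_eq_swap_mul a x (a x)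
    rwa [haa, swap_comm (a x) x] at this
  refine ⟨swap x (a x), swap x (a x) * a, by simp, ⟨x, a x, hx.symm, rfl⟩, ?_, ?_⟩
  · intro y
    by_cases h1 : y = x
    · right; subst h1; simp
    by_cases h2 : y = a x
    · right; subst h2; simp [haa]
    · left; exact swap_apply_of_ne_of_ne h1 h2
  · calc swap x (a x) * a * (swap x (a x) * a)
        = swap x (a x) * (a * swap x (a x)) * a := by group
      _ = 1 := by rw [hcomm, ← mul_assoc, swap_mul_self, one_mul, ha]

theorem exists_split_involution {a : Perm α} (ha : a * a = 1) (k : ℕ)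
    (hk : 2 * k ≤ a.support.card) :
    ∃ a₁ a₂ : Perm α, a = a₁ * a₂ ∧ Perm.Disjoint a₁ a₂ ∧ a₁ * a₁ = 1 ∧ a₂ * a₂ = 1 ∧
      a₁.support.card = 2 * k := by
  induction k with
  | zero => exact ⟨1, a, by simp, disjoint_one_left a, by simp, ha, by simp⟩
  | succ k ih =>
    obtain ⟨a₁, a₂, rfl, hd, h1, h2, hc⟩ := ih (by omega)
    have hne : a₂ ≠ 1 := by
      rintro rfl
      rw [mul_one] at hk
      omega
    obtain ⟨s, b, rfl, hs, hsb, hb⟩ := exists_swap_mul_of_involution h2 hne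
    have hsupp := hsb.support_mul
    have hd1 : Perm.Disjoint a₁ s :=
      hd.mono le_rfl (by rw [hsupp]; exact Finset.subset_union_left)
    have hd2 : Perm.Disjoint a₁ b :=
      hd.mono le_rfl (by rw [hsupp]; exact Finset.subset_union_right)
    have hss : s * s = 1 := by
      obtain ⟨x, y, -, rfl⟩ := hs
      exact swap_mul_self x y
    exact ⟨a₁ * s, b, by group, hd2.mul_left hsb, mul_self_of_disjoint hd1 h1 hss, hb, by
      rw [hd1.card_support_mul, hc, card_support_eq_two.2 hs]; ring⟩

theorem isConj_of_involution {a b : Perm α} (ha : a * a = 1) (hb : b * b = 1)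
    (h : a.support.card = b.support.card) : IsConj a b := by
  rw [isConj_iff_cycleType_eq]
  have h1 := cycleType_of_pow_prime_eq_one (p := 2) (by rw [pow_two]; exact ha)
  have h2 := cycleType_of_pow_prime_eq_one (p := 2) (by rw [pow_two]; exact hb)
  rw [← sum_cycleType, ← sum_cycleType, h1, h2, Multiset.sum_replicate,
    Multiset.sum_replicate] at h
  rw [h1, h2]
  congr 1
  simpa using h

theorem exists_involution_of_card_le (A : Finset α) (k : ℕ) (hk : 2 * k ≤ A.card) :
    ∃ h : Perm α, h * h = 1 ∧ h.support ⊆ A ∧ h.support.card = 2 * k ∧ sign h = (-1) ^ k := by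
  induction k with
  | zero => exact ⟨1, by simp, by simp, by simp, by simp⟩
  | succ k ih =>
    obtain ⟨h, h1, h2, h3, h4⟩ := ih (by omega)
    have : 1 < (A \ h.support).card := by
      rw [Finset.card_sdiff_of_subset h2]; omega
    obtain ⟨u, hu, v, hv, huv⟩ := Finset.one_lt_card.1 this
    rw [Finset.mem_sdiff] at hu hv
    have hd : Perm.Disjoint h (swap u v) := by
      rw [disjoint_iff_disjoint_support, support_swap huv, Finset.disjoint_right]
      intro z hz
      rw [Finset.mem_insert, Finset.mem_singleton] at hz
      rcases hz with rfl | rfl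
      exacts [hu.2, hv.2]
    refine ⟨h * swap u v, mul_self_of_disjoint hd h1 (swap_mul_self u v), ?_, ?_, ?_⟩
    · rw [hd.support_mul, support_swap huv]
      refine Finset.union_subset h2 ?_
      intro z hz
      rw [Finset.mem_insert, Finset.mem_singleton] at hz
      rcases hz with rfl | rfl
      exacts [hu.1, hv.1]
    · rw [hd.card_support_mul, h3, card_support_swap huv]; ring
    · rw [Perm.sign_mul, h4, sign_swap huv, pow_succ]

/-- Any `A` of maximal size among the sets disjoint from their image under `x` will do: by
maximality, the support of `x` is covered by `A`, `x A` and `x⁻¹ A`. -/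
theorem exists_finset_disjoint_image (x : Perm α) :
    ∃ A : Finset α, (∀ a ∈ A, x a ∉ A) ∧ x.support.card ≤ 3 * A.card := by
  obtain ⟨A, hA, hmax⟩ := Finset.exists_max_image
    (Finset.univ.filter fun A : Finset α => ∀ a ∈ A, x a ∉ A) Finset.card ⟨∅, by simp⟩
  simp only [Finset.mem_filter, Finset.mem_univ, true_and] at hA hmax
  refine ⟨A, hA, ?_⟩
  have hsub : x.support ⊆ A ∪ (A.image x ∪ A.image x.symm) := by
    intro p hp
    rw [mem_support] at hp
    by_contra hcon
    simp only [Finset.mem_union, Finset.mem_image, not_or, not_exists, not_and] at hcon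
    obtain ⟨h1, h2, h3⟩ := hcon
    have := hmax (insert p A) (by
      intro a ha hxa
      rw [Finset.mem_insert] at ha hxa
      rcases ha with rfl | ha
      · rcases hxa with h | h
        · exact hp h
        · exact h3 _ h (by simp)
      · rcases hxa with h | h
        · exact h2 a ha h
        · exact hA a ha h)
    rw [Finset.card_insert_of_notMem h1] at this
    omega
  calc x.support.card ≤ _ := Finset.card_le_card hsub
    _ ≤ A.card + ((A.image x).card + (A.image x.symm).card) :=
        (Finset.card_union_le _ _).trans (Nat.add_le_add_left (Finset.card_union_le _ _) _)
    _ ≤ A.card + (A.card + A.card) :=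
        Nat.add_le_add_left (Nat.add_le_add Finset.card_image_le Finset.card_image_le) _
    _ = 3 * A.card := by ring

/-! ### Products of conjugates of commutators -/

/-- The set of conjugates, by even permutations, of commutators `[x, h]` with `h` even. The powers
of this set are pointwise powers: `commConj x ^ n` consists of the products of `n` of its
elements. -/
def commConj (x : Perm α) : Set (Perm α) :=
  {y | ∃ h ∈ alternatingGroup α, ∃ k ∈ alternatingGroup α, y = k * (x * h * x⁻¹ * h⁻¹) * k⁻¹}

theorem one_mem_commConj (x : Perm α) : 1 ∈ commConj x :=
  ⟨1, one_mem _, 1, one_mem _, by simp⟩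

theorem inv_commConj (x : Perm α) : (commConj x)⁻¹ = commConj x := by
  have key : ∀ y ∈ commConj x, y⁻¹ ∈ commConj x := by
    rintro _ ⟨h, hh, k, hk, rfl⟩
    exact ⟨h⁻¹, inv_mem hh, k * h, mul_mem hk hh, by group⟩
  ext y
  rw [Set.mem_inv]
  exact ⟨fun h => by simpa using key _ h, key y⟩

theorem conj_mem_commConj_pow {x y k : Perm α} {n : ℕ} (hy : y ∈ commConj x ^ n)
    (hk : k ∈ alternatingGroup α) : k * y * k⁻¹ ∈ commConj x ^ n := by
  induction n generalizing y with
  | zero =>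
    rw [pow_zero, Set.mem_one] at hy
    simp [hy]
  | succ n ih =>
    rw [pow_succ, Set.mem_mul] at hy ⊢
    obtain ⟨a, ha, _, ⟨h, hh, l, hl, rfl⟩, rfl⟩ := hy
    exact ⟨_, ih ha, _, ⟨h, hh, k * l, mul_mem hk hl, rfl⟩, by group⟩

theorem sign_of_mem_commConj_pow {x y : Perm α} {n : ℕ} (hy : y ∈ commConj x ^ n) :
    sign y = 1 := by
  induction n generalizing y with
  | zero =>
    rw [pow_zero, Set.mem_one] at hy
    simp [hy]
  | succ n ih =>
    rw [pow_succ, Set.mem_mul] at hy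
    obtain ⟨a, ha, _, ⟨h, hh, l, hl, rfl⟩, rfl⟩ := hy
    rw [mem_alternatingGroup] at hh
    simp [ih ha, hh]

theorem commConj_pow_mono (x : Perm α) {m n : ℕ} (h : m ≤ n) : commConj x ^ m ⊆ commConj x ^ n :=
  Set.pow_subset_pow_right (one_mem_commConj x) h

theorem mem_commConj_of_isConj {x y z : Perm α} (hy : y ∈ commConj x) (hyz : IsConj y z)
    (hc : y.support.card + 2 ≤ Fintype.card α) : z ∈ commConj x := by
  have hsy : sign y = 1 := sign_of_mem_commConj_pow (n := 1) (by simpa using hy)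
  have hsz : sign z = 1 := by
    rw [← hsy, ← isConj_iff_eq]
    exact (sign.map_isConj hyz).symm
  have hconj : IsConj (⟨y, hsy⟩ : alternatingGroup α) ⟨z, hsz⟩ :=
    alternatingGroup.isConj_of hyz hc
  obtain ⟨k, hk⟩ := isConj_iff.1 hconj
  have hk' : (k : Perm α) * y * (k : Perm α)⁻¹ = z := congrArg Subtype.val hk
  have := conj_mem_commConj_pow (n := 1) (by simpa using hy) k.2
  rwa [hk', pow_one] at this

/-- Let `A` be disjoint from `x A`, and let `h` be a product of `2 * r` disjoint transpositions in
`A`. Then `[x, h]` is a product of `4 * r` disjoint transpositions, `2 * r` of them in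
`A` and `2 * r` in `x A`, and all such involutions are conjugate. -/
theorem involution_mem_commConj {x y : Perm α} {r : ℕ} (hr : 12 * r ≤ x.support.card)
    (hy : y * y = 1) (hc : y.support.card = 8 * r) : y ∈ commConj x := by
  rcases Nat.eq_zero_or_pos r with rfl | hpos
  · rw [mul_zero, card_support_eq_zero] at hc
    rw [hc]; exact one_mem_commConj x
  obtain ⟨A, hA, hAc⟩ := exists_finset_disjoint_image x
  obtain ⟨h, h1, h2, h3, h4⟩ := exists_involution_of_card_le A (2 * r) (by omega)
  have hinv : h⁻¹ = h := inv_eq_of_mul_eq_one_left h1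
  have heven : h ∈ alternatingGroup α := by
    rw [mem_alternatingGroup, h4, pow_mul]; simp
  have hd : Perm.Disjoint (x * h * x⁻¹) h := by
    rw [disjoint_iff_disjoint_support, support_conj, Finset.disjoint_left]
    intro z hz hz'
    obtain ⟨w, hw, rfl⟩ := Finset.mem_map.1 hz
    exact hA w (h2 hw) (h2 hz')
  have hcomm : (x * h * x⁻¹ * h⁻¹) * (x * h * x⁻¹ * h⁻¹) = 1 := by
    rw [hinv]
    refine mul_self_of_disjoint hd ?_ h1
    calc x * h * x⁻¹ * (x * h * x⁻¹) = x * (h * h) * x⁻¹ := by group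
      _ = 1 := by rw [h1]; group
  have hcard : (x * h * x⁻¹ * h⁻¹).support.card = 8 * r := by
    rw [hinv, hd.card_support_mul, card_support_conj, h3]; ring
  refine mem_commConj_of_isConj (y := x * h * x⁻¹ * h⁻¹) ⟨h, heven, 1, one_mem _, by group⟩
    (isConj_of_involution hcomm hy (hcard.trans hc.symm)) ?_
  have := Finset.card_le_univ x.support
  omega

/-- Multiply each of the two transpositions by the same three further disjoint ones, which cancel in
the product. -/
theorem swap_mul_swap_mem_of_large {x σ τ : Perm α} (hx : 12 ≤ x.support.card) (hσ : σ.IsSwap)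
    (hτ : τ.IsSwap) : σ * τ ∈ commConj x ^ 2 := by
  have hσc := card_support_eq_two.2 hσ
  have hτc := card_support_eq_two.2 hτ
  have hσ1 : σ * σ = 1 := by obtain ⟨u, v, -, rfl⟩ := hσ; exact swap_mul_self u v
  have hτ1 : τ * τ = 1 := by obtain ⟨u, v, -, rfl⟩ := hτ; exact swap_mul_self u v
  have hcard := Finset.card_le_univ x.support
  -- Since `x` moves at least 12 points, six of them lie outside the two transpositions.
  obtain ⟨e, h1, h2, h3, -⟩ := exists_involution_of_card_le (σ.support ∪ τ.support)ᶜ 3 (by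
    rw [Finset.card_compl]
    have := Finset.card_union_le σ.support τ.support
    omega)
  have hdis : _root_.Disjoint e.support (σ.support ∪ τ.support) :=
    (Finset.subset_compl_iff_disjoint_right).1 h2
  have hσe : Perm.Disjoint σ e := by
    rw [disjoint_iff_disjoint_support]
    exact (hdis.mono_right Finset.subset_union_left).symm
  have heτ : Perm.Disjoint e τ := by
    rw [disjoint_iff_disjoint_support]
    exact hdis.mono_right Finset.subset_union_right
  rw [pow_two, Set.mem_mul]
  refine ⟨σ * e, ?_, e * τ, ?_, ?_⟩
  · exact involution_mem_commConj (r := 1) (by omega) (mul_self_of_disjoint hσe hσ1 h1)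
      (by rw [hσe.card_support_mul]; omega)
  · exact involution_mem_commConj (r := 1) (by omega) (mul_self_of_disjoint heτ h1 hτ1)
      (by rw [heτ.card_support_mul]; omega)
  · calc σ * e * (e * τ) = σ * (e * e) * τ := by group
      _ = σ * τ := by rw [h1, mul_one]

theorem even_mem_of_swap_mul_swap_mem {S : Set (Perm α)} (h1 : 1 ∈ S)
    (hS : ∀ σ τ : Perm α, σ.IsSwap → τ.IsSwap → σ * τ ∈ S) (n : ℕ) (g : Perm α)
    (hg : sign g = 1) (hn : g.support.card ≤ n) : g ∈ S ^ n := by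
  have aux : ∀ g : Perm α, g ≠ 1 → ∃ s g' : Perm α, s.IsSwap ∧ g = s * g' ∧
      g'.support.card < g.support.card := by
    intro g hg
    obtain ⟨x, hx⟩ : ∃ x, g x ≠ x := by
      by_contra! h
      exact hg (Perm.ext h)
    exact ⟨swap x (g x), swap x (g x) * g, ⟨x, g x, hx.symm, rfl⟩, by simp,
      card_support_swap_mul hx⟩
  induction n generalizing g with
  | zero =>
    rw [Nat.le_zero, card_support_eq_zero] at hn
    simp [hn]
  | succ n ih =>
    by_cases hg1 : g = 1
    · rw [hg1]; exact Set.one_mem_pow h1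
    obtain ⟨s, g', hs, rfl, hlt⟩ := aux g hg1
    have hg' : g' ≠ 1 := by
      rintro rfl
      rw [mul_one, hs.sign_eq] at hg
      exact absurd hg (by decide)
    obtain ⟨t, g'', ht, rfl, hlt'⟩ := aux g' hg'
    rw [pow_succ', Set.mem_mul]
    refine ⟨s * t, hS s t hs ht, g'', ih g'' ?_ (by omega), by group⟩
    simpa [hs.sign_eq, ht.sign_eq] using hg

/-- The involution `a` is cut into pieces with support of size `8 * (|supp x| / 12)`, a shorter
piece whose support has a size divisible by 8, and a remainder that moves at most 7 points. -/
theorem involution_eq_mul_of_large {x : Perm α} (n : ℕ) {a : Perm α} (ha : a * a = 1)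
    (hn : a.support.card ≤ n * (8 * (x.support.card / 12))) :
    ∃ u w : Perm α, a = u * w ∧ u ∈ commConj x ^ (n + 1) ∧ w.support.card ≤ 7 := by
  induction n generalizing a with
  | zero =>
    rw [zero_mul, Nat.le_zero, card_support_eq_zero] at hn
    exact ⟨1, 1, by simp [hn], Set.one_mem_pow (one_mem_commConj x), by simp⟩
  | succ n ih =>
    by_cases hle : 8 * (x.support.card / 12) ≤ a.support.card
    · obtain ⟨a₁, a₂, rfl, hd, h1, h2, hc⟩ :=
        exists_split_involution ha (4 * (x.support.card / 12)) (by omega)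
      have hcm := hd.card_support_mul
      obtain ⟨u, w, rfl, hu, hw⟩ := ih h2 (by rw [add_mul, one_mul] at hn; omega)
      refine ⟨a₁ * u, w, by group, ?_, hw⟩
      rw [pow_succ']
      exact Set.mul_mem_mul (involution_mem_commConj (Nat.mul_div_le _ _) h1 (by omega)) hu
    · obtain ⟨a₁, a₂, rfl, hd, h1, h2, hc⟩ :=
        exists_split_involution ha (4 * (a.support.card / 8)) (by omega)
      have hcm := hd.card_support_mul
      refine ⟨a₁, a₂, rfl, ?_, by omega⟩
      refine commConj_pow_mono x (Nat.le_add_left 1 (n + 1)) ?_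
      rw [pow_one]
      exact involution_mem_commConj (r := (a₁ * a₂).support.card / 8) (by omega) h1 (by omega)

/-! ### The uniform bound on the number of commutators -/

theorem mem_commConj_pow_of_large {x g : Perm α} (C : ℕ) (hx : 12 ≤ x.support.card)
    (hg : sign g = 1) (hC : g.support.card ≤ C * x.support.card) :
    g ∈ commConj x ^ (6 * C + 30) := by
  obtain ⟨a, ha, hb, hfix⟩ := exists_involution_mul_involution g
  have hsa : a.support ⊆ g.support := fun y hy => by
    rw [mem_support] at hy ⊢
    exact fun h => hy (hfix y h)
  have hsb : (a * g).support ⊆ g.support := fun y hy => by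
    rw [mem_support] at hy ⊢
    exact fun h => hy (by rw [Perm.mul_apply, h, hfix y h])
  -- For `c ≥ 12` one has `c ≤ 24 * (c / 12)`, so `3 * C` full pieces suffice.
  have hbound : C * x.support.card ≤ 3 * C * (8 * (x.support.card / 12)) := by
    calc C * x.support.card ≤ C * (24 * (x.support.card / 12)) :=
          Nat.mul_le_mul_left _ (by omega)
      _ = _ := by ring
  obtain ⟨u, w, hu, huS, hw⟩ := involution_eq_mul_of_large (x := x) (3 * C) ha
    ((Finset.card_le_card hsa).trans (hC.trans hbound))
  obtain ⟨u', w', hu', huS', hw'⟩ := involution_eq_mul_of_large (x := x) (3 * C) hb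
    ((Finset.card_le_card hsb).trans (hC.trans hbound))
  have hg' : g = u * (w * w'⁻¹) * u'⁻¹ := by
    have h1 : a * g = w'⁻¹ * u'⁻¹ := by
      rw [← mul_inv_rev, ← hu']; exact (inv_eq_of_mul_eq_one_left hb).symm
    calc g = a * a * g := by rw [ha, one_mul]
      _ = a * (a * g) := by group
      _ = u * w * (w'⁻¹ * u'⁻¹) := by rw [h1, ← hu]
      _ = _ := by group
  have hsign : sign (w * w'⁻¹) = 1 := by
    have h2 := congrArg sign hg'
    rw [hg, Perm.sign_mul, Perm.sign_mul, sign_inv, sign_of_mem_commConj_pow huS,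
      sign_of_mem_commConj_pow huS'] at h2
    simpa using h2.symm
  -- The two remainders combine to an even permutation of bounded support.
  have hcard : (w * w'⁻¹).support.card ≤ 14 := by
    refine (Finset.card_le_card (support_mul_le w w'⁻¹)).trans ?_
    refine (Finset.card_union_le _ _).trans ?_
    rw [support_inv]
    omega
  have hmid : w * w'⁻¹ ∈ (commConj x ^ 2) ^ 14 :=
    even_mem_of_swap_mul_swap_mem (Set.one_mem_pow (one_mem_commConj x))
      (fun σ τ hσ hτ => swap_mul_swap_mem_of_large hx hσ hτ) 14 _ hsign hcard
  have hend : u'⁻¹ ∈ commConj x ^ (3 * C + 1) := by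
    rw [← inv_commConj, inv_pow]
    simpa using huS'
  rw [hg', show 6 * C + 30 = (3 * C + 1) + 2 * 14 + (3 * C + 1) by ring, pow_add, pow_add, pow_mul]
  exact Set.mul_mem_mul (Set.mul_mem_mul huS hmid) hend

/-- If `x` moves `a` and fixes `u`, `v`, `w`, then its commutator with `(a u)(v w)` is a 3-cycle; an
even permutation that moves at most `n` points is a product of `2 * n` 3-cycles, up to trivial
factors. -/
theorem mem_commConj_pow_of_three_fixed {x g : Perm α} (h5 : 5 ≤ Fintype.card α) (hx : x ≠ 1)
    (hfix : x.support.card + 3 ≤ Fintype.card α) (n : ℕ) (hg : sign g = 1)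
    (hn : g.support.card ≤ n) : g ∈ commConj x ^ (2 * n) := by
  obtain ⟨a, ha⟩ : ∃ a, x a ≠ a := by
    by_contra! h
    exact hx (Perm.ext h)
  obtain ⟨u, v, w, hu, hv, hw, huv, huw, hvw⟩ := Finset.two_lt_card_iff.1
    (show 2 < (x.supportᶜ).card by rw [Finset.card_compl]; omega)
  rw [Finset.mem_compl, notMem_support] at hu hv hw
  have hua : u ≠ a := by rintro rfl; exact ha hu
  have huxa : u ≠ x a := fun h => hua (x.injective (hu.trans h))
  have hthree : ∀ z : Perm α, z.IsThreeCycle → z ∈ commConj x := by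
    intro z hz
    have hy : (swap u (x a) * swap u a).IsThreeCycle :=
      isThreeCycle_swap_mul_swap_same huxa hua ha
    refine mem_commConj_of_isConj (y := swap u (x a) * swap u a) ?_
      (isConj_iff_cycleType_eq.2 (hy.trans hz.symm)) (by rw [hy.card_support]; exact h5)
    refine ⟨swap u a * swap v w, ?_, 1, one_mem _, ?_⟩
    · rw [mem_alternatingGroup, Perm.sign_mul, sign_swap hua, sign_swap hvw]; simp
    · have e1 : x * swap u a = swap u (x a) * x := by
        rw [mul_swap_eq_swap_mul, hu]
      have e2 : x * swap v w = swap v w * x := by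
        rw [mul_swap_eq_swap_mul, hv, hw]
      have e3 : x * (swap u a * swap v w) * x⁻¹ = swap u (x a) * swap v w := by
        rw [← mul_assoc, e1, mul_assoc (swap u (x a)), e2]; group
      rw [e3, mul_inv_rev, swap_inv, swap_inv, one_mul, inv_one, mul_one]
      calc swap u (x a) * swap u a = swap u (x a) * 1 * swap u a := by rw [mul_one]
        _ = _ := by rw [← swap_mul_self v w]; group
  have hadj : ∀ p q r : α, p ≠ q → p ≠ r → swap p q * swap p r ∈ commConj x := by
    intro p q r hpq hpr
    by_cases hqr : q = r
    · rw [hqr, swap_mul_self]; exact one_mem_commConj x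
    · exact hthree _ (isThreeCycle_swap_mul_swap_same hpq hpr hqr)
  have hpair : ∀ σ τ : Perm α, σ.IsSwap → τ.IsSwap → σ * τ ∈ commConj x ^ 2 := by
    rintro _ _ ⟨p, q, hpq, rfl⟩ ⟨r, s, hrs, rfl⟩
    by_cases hqr : q = r
    · subst hqr
      refine commConj_pow_mono x (m := 1) (by omega) ?_
      rw [pow_one, swap_comm p q]
      exact hadj q p s hpq.symm hrs
    · rw [pow_two, Set.mem_mul]
      refine ⟨swap q p * swap q r, hadj q p r hpq.symm hqr, swap r q * swap r s,
        hadj r q s (Ne.symm hqr) hrs, ?_⟩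
      rw [swap_comm r q, swap_comm q p]
      calc swap p q * swap q r * (swap q r * swap r s)
          = swap p q * (swap q r * swap q r) * swap r s := by group
        _ = _ := by rw [swap_mul_self, mul_one]
  rw [pow_mul]
  exact even_mem_of_swap_mul_swap_mem (Set.one_mem_pow (one_mem_commConj x)) hpair n g hg hn

/-- The elements of all `commConj x ^ n` form a nontrivial normal subgroup of the simple group
`alternatingGroup α`. -/
theorem exists_mem_commConj_pow {x g : Perm α} (h5 : 5 ≤ Fintype.card α) (hx : x ≠ 1)
    (hg : sign g = 1) : ∃ n, g ∈ commConj x ^ n := by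
  let N : Subgroup (alternatingGroup α) :=
    { carrier := {y | ∃ n, (y : Perm α) ∈ commConj x ^ n}
      one_mem' := ⟨0, by simp⟩
      mul_mem' := by
        rintro a b ⟨m, hm⟩ ⟨n, hn⟩
        exact ⟨m + n, by rw [pow_add]; exact Set.mul_mem_mul hm hn⟩
      inv_mem' := by
        rintro a ⟨n, hn⟩
        refine ⟨n, ?_⟩
        rw [← inv_commConj, inv_pow]
        simpa using hn }
  have hN : N.Normal := ⟨by
    rintro a ⟨n, hn⟩ k
    exact ⟨n, conj_mem_commConj_pow hn k.2⟩⟩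
  have hsimple : IsSimpleGroup (alternatingGroup α) :=
    alternatingGroup.isSimpleGroup (by rwa [Nat.card_eq_fintype_card])
  rcases hN.eq_bot_or_eq_top with hbot | htop
  · exfalso
    obtain ⟨a, ha⟩ : ∃ a, x a ≠ a := by
      by_contra! h
      exact hx (Perm.ext h)
    obtain ⟨u, hu, v, hv, huv⟩ := Finset.one_lt_card.1
      (show 1 < (({a, x a} : Finset α)ᶜ).card by
        rw [Finset.card_compl, Finset.card_pair ha.symm]; omega)
    simp only [Finset.mem_compl, Finset.mem_insert, Finset.mem_singleton, not_or] at hu hv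
    have hh : (swap (x a) u * swap (x a) v).IsThreeCycle :=
      isThreeCycle_swap_mul_swap_same (Ne.symm hu.2) (Ne.symm hv.2) huv
    -- The 3-cycle `h` moves `x a` and fixes `a`, so it does not commute with `x`.
    set h := swap (x a) u * swap (x a) v with hdef
    have hmem : x * h * x⁻¹ * h⁻¹ ∈ commConj x :=
      ⟨h, hh.mem_alternatingGroup, 1, one_mem _, by group⟩
    have heven : x * h * x⁻¹ * h⁻¹ ∈ alternatingGroup α :=
      sign_of_mem_commConj_pow (x := x) (n := 1) (by simpa using hmem)
    have h1 : (⟨_, heven⟩ : alternatingGroup α) ∈ N := ⟨1, by simpa using hmem⟩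
    rw [hbot, Subgroup.mem_bot] at h1
    have h2 : x * h * x⁻¹ * h⁻¹ = 1 := congrArg Subtype.val h1
    have h3 : x * h = h * x := by
      calc x * h = (x * h * x⁻¹ * h⁻¹) * (h * x) := by group
        _ = h * x := by rw [h2, one_mul]
    have h4 := congrArg (fun p : Perm α => p a) h3
    simp only [Perm.mul_apply] at h4
    have h5 : h a = a := by
      rw [hdef, Perm.mul_apply, swap_apply_of_ne_of_ne ha.symm (Ne.symm hv.1),
        swap_apply_of_ne_of_ne ha.symm (Ne.symm hu.1)]
    have h6 : h (x a) = v := by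
      rw [hdef, Perm.mul_apply, swap_apply_left, swap_apply_of_ne_of_ne hv.2 (Ne.symm huv)]
    rw [h5, h6] at h4
    exact hv.2 h4.symm
  · have : (⟨g, hg⟩ : alternatingGroup α) ∈ N := by rw [htop]; exact Subgroup.mem_top _
    exact this

end Combinatorics

/-- The bound `T` depends on the ratio `C` of the supports but not on the degree `m`. -/
theorem exists_uniform_commConj_pow (C : ℕ) :
    ∃ T : ℕ, ∀ (m : ℕ) (x g : Perm (Fin m)), 5 ≤ m → sign g = 1 →
      g.support.card ≤ C * x.support.card → g ∈ commConj x ^ T := by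
  have hsmall : ∀ m : ℕ, ∃ T : ℕ, 5 ≤ m → ∀ x g : Perm (Fin m), x ≠ 1 → sign g = 1 →
      g ∈ commConj x ^ T := by
    intro m
    by_cases hm : 5 ≤ m
    · have h : ∀ p : Perm (Fin m) × Perm (Fin m), ∃ n, p.1 ≠ 1 → sign p.2 = 1 →
          p.2 ∈ commConj p.1 ^ n := by
        rintro ⟨x, g⟩
        by_cases hx : x ≠ 1
        · by_cases hg : sign g = 1
          · obtain ⟨n, hn⟩ := exists_mem_commConj_pow (by simpa using hm) hx hg
            exact ⟨n, fun _ _ => hn⟩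
          · exact ⟨0, fun _ h => absurd h hg⟩
        · exact ⟨0, fun h => absurd h hx⟩
      choose n hn using h
      exact ⟨Finset.univ.sup n, fun _ x g hx hg =>
        commConj_pow_mono x (Finset.le_sup (f := n) (Finset.mem_univ (x, g))) (hn (x, g) hx hg)⟩
    · exact ⟨0, fun h => absurd h hm⟩
  choose T hT using hsmall
  refine ⟨6 * C + 30 + 2 * (C * 12) + (Finset.range 15).sup T, fun m x g hm hg hC => ?_⟩
  by_cases hx : x = 1
  · rw [hx, support_one, Finset.card_empty, mul_zero, Nat.le_zero, card_support_eq_zero] at hC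
    rw [hC]
    exact Set.one_mem_pow (one_mem_commConj x)
  by_cases hlarge : 12 ≤ x.support.card
  · exact commConj_pow_mono x (by omega) (mem_commConj_pow_of_large C hlarge hg hC)
  by_cases hm15 : m < 15
  · have := Finset.le_sup (f := T) (Finset.mem_range.2 hm15)
    exact commConj_pow_mono x (by omega) (hT m hm x g hx hg)
  · refine commConj_pow_mono x (m := 2 * (C * 12)) (by omega)
      (mem_commConj_pow_of_three_fixed (by simpa using hm) hx (by rw [Fintype.card_fin]; omega)
        _ hg (hC.trans (Nat.mul_le_mul_left _ (by omega))))

/-! ### The proportion of moved points -/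

section Length

/-- The proportion of points moved by a permutation of a finite set. This is the normalized Hamming
length, here for permutations of arbitrary types; on infinite or empty types it carries no
meaning. -/
noncomputable def moved {β : Type*} (σ : Perm β) : ℝ :=
  (Nat.card {b // σ b ≠ b} : ℝ) / Nat.card β

variable {β : Type*}

theorem moved_nonneg (σ : Perm β) : 0 ≤ moved σ := by unfold moved; positivity

theorem moved_one : moved (1 : Perm β) = 0 := by simp [moved]

theorem moved_mul_le [Finite β] (σ τ : Perm β) : moved (σ * τ) ≤ moved σ + moved τ := by
  unfold moved
  rw [← add_div]
  gcongr
  norm_cast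
  change Nat.card {b | (σ * τ) b ≠ b} ≤ Nat.card {b | σ b ≠ b} + Nat.card {b | τ b ≠ b}
  rw [Nat.card_coe_set_eq, Nat.card_coe_set_eq, Nat.card_coe_set_eq]
  refine (Set.ncard_le_ncard (set_support_mul_subset σ τ) (Set.toFinite _)).trans
    (Set.ncard_union_le _ _)

theorem moved_inv (σ : Perm β) : moved σ⁻¹ = moved σ := by
  unfold moved
  congr 2
  refine Nat.card_congr (Equiv.subtypeEquivRight fun b => ?_)
  rw [Ne, inv_eq_iff_eq, eq_comm]

theorem moved_conj (σ τ : Perm β) : moved (τ⁻¹ * σ * τ) = moved σ := by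
  unfold moved
  congr 2
  refine Nat.card_congr (τ.subtypeEquiv fun b => ?_)
  rw [Perm.mul_apply, Perm.mul_apply, Ne, inv_eq_iff_eq]

theorem moved_permCongr {γ : Type*} (e : β ≃ γ) (σ : Perm β) : moved (e.permCongr σ) = moved σ := by
  unfold moved
  rw [Nat.card_congr e]
  congr 2
  exact (Nat.card_congr (e.subtypeEquiv fun b => by simp)).symm

theorem moved_eq_one_sub [Finite β] [Nonempty β] (σ : Perm β) :
    moved σ = 1 - (Nat.card {b // σ b = b} : ℝ) / Nat.card β := by
  have hpos : (0 : ℝ) < Nat.card β := by exact_mod_cast Nat.card_pos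
  have h : Nat.card {b // σ b = b} + Nat.card {b // ¬ σ b = b} = Nat.card β := by
    classical
    rw [← Nat.card_sum]
    exact Nat.card_congr (Equiv.sumCompl fun b => σ b = b)
  have h' : (Nat.card {b // σ b = b} : ℝ) + Nat.card {b // ¬ σ b = b} = Nat.card β := by
    exact_mod_cast h
  unfold moved
  rw [eq_sub_iff_add_eq, ← add_div, div_eq_one_iff_eq hpos.ne', add_comm]
  exact h'

theorem moved_le_one [Finite β] [Nonempty β] (σ : Perm β) : moved σ ≤ 1 := by
  rw [moved_eq_one_sub]
  have : (0 : ℝ) ≤ (Nat.card {b // σ b = b} : ℝ) / Nat.card β := by positivity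
  linarith

theorem moved_fin {m : ℕ} (σ : Perm (Fin m)) : hammingLength σ = moved σ := by
  unfold hammingLength moved
  rw [Nat.card_eq_fintype_card, Nat.card_eq_fintype_card, Fintype.card_fin,
    Fintype.card_subtype]
  rfl

/-- In the action on a product of sets, proportions of fixed points multiply. -/
theorem one_sub_moved_piCongrRight {ι : Type*} [Fintype ι] {β : ι → Type*} [∀ i, Finite (β i)]
    [∀ i, Nonempty (β i)] (σ : ∀ i, Perm (β i)) :
    1 - moved (Equiv.piCongrRight σ) = ∏ i, (1 - moved (σ i)) := by
  simp only [moved_eq_one_sub, sub_sub_cancel]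
  rw [Finset.prod_div_distrib, ← Nat.cast_prod, ← Nat.cast_prod, ← Nat.card_pi, ← Nat.card_pi]
  congr 2
  refine Nat.card_congr ((Equiv.subtypeEquivRight fun f => ?_).trans Equiv.subtypePiEquivPi)
  exact funext_iff

theorem one_sub_sum_le_prod_one_sub {ι : Type*} (s : Finset ι) (f : ι → ℝ) (h0 : ∀ i, 0 ≤ f i)
    (h1 : ∀ i, f i ≤ 1) : 1 - ∑ i ∈ s, f i ≤ ∏ i ∈ s, (1 - f i) := by
  classical
  induction s using Finset.induction_on with
  | empty => simp
  | insert a s ha ih =>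
    rw [Finset.sum_insert ha, Finset.prod_insert ha]
    have hs : 0 ≤ ∑ i ∈ s, f i := Finset.sum_nonneg fun i _ => h0 i
    calc 1 - (f a + ∑ i ∈ s, f i) ≤ (1 - f a) * (1 - ∑ i ∈ s, f i) := by
          nlinarith [mul_nonneg (h0 a) hs]
      _ ≤ _ := mul_le_mul_of_nonneg_left ih (sub_nonneg.2 (h1 a))

/-- The action of `P` on a product of sets, each of which carries an action `ρ i`. -/
def piPermHom {P ι : Type*} [Group P] {β : ι → Type*} (ρ : ∀ i, P →* Perm (β i)) :
    P →* Perm (∀ i, β i) :=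
  MonoidHom.mk' (fun p => Equiv.piCongrRight fun i => ρ i p) fun a b => by
    ext f i
    simp

variable {P ι : Type*} [Group P] [Fintype ι] {γ : ι → Type*} [∀ i, Finite (γ i)]
  [∀ i, Nonempty (γ i)] (ρ : ∀ i, P →* Perm (γ i)) (p : P)

theorem one_sub_moved_piPermHom : 1 - moved (piPermHom ρ p) = ∏ i, (1 - moved (ρ i p)) :=
  one_sub_moved_piCongrRight fun i => ρ i p

theorem le_moved_piPermHom (i : ι) : moved (ρ i p) ≤ moved (piPermHom ρ p) := by
  classical
  have h := one_sub_moved_piPermHom ρ p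
  rw [← Finset.mul_prod_erase _ _ (Finset.mem_univ i)] at h
  have h1 : ∏ j ∈ Finset.univ.erase i, (1 - moved (ρ j p)) ≤ 1 :=
    Finset.prod_le_one (fun j _ => sub_nonneg.2 (moved_le_one _))
      fun j _ => sub_le_self _ (moved_nonneg _)
  have h2 := mul_le_of_le_one_right (sub_nonneg.2 (moved_le_one (ρ i p))) h1
  linarith

theorem moved_piPermHom_le : moved (piPermHom ρ p) ≤ ∑ i, moved (ρ i p) := by
  have h := one_sub_moved_piPermHom ρ p
  have h1 : 1 - ∑ i, moved (ρ i p) ≤ ∏ i, (1 - moved (ρ i p)) :=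
    one_sub_sum_le_prod_one_sub Finset.univ _ (fun i => moved_nonneg _) fun i => moved_le_one _
  linarith

end Length

/-! ### Amplification by the action on tuples -/

section Amplification

/-- With `δ` the length of `ρ d`, act on tuples of length `k = ⌈1 / δ⌉`: the proportion of fixed
points of `d` becomes `(1 - δ) ^ k ≤ exp (-1)`, while lengths grow at most by the factor
`k ≤ 2 / δ`. -/
theorem exists_amplification {P : Type*} [Group P] {m : ℕ} (hm : 1 ≤ m) (ρ : P →* Perm (Fin m))
    (d : P) (hd : ρ d ≠ 1) :
    ∃ (β : Type) (_ : Finite β) (_ : Nonempty β) (θ : P →* Perm β), 1 / 2 ≤ moved (θ d) ∧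
      ∀ (x : P) (C : ℝ), 0 < C → C * moved (ρ x) ≤ moved (ρ d) → moved (θ x) ≤ 2 / C := by
  have : Nonempty (Fin m) := ⟨⟨0, hm⟩⟩
  set δ := moved (ρ d) with hδ
  have hδ0 : 0 < δ := by
    have h0 : ∃ b, ρ d b ≠ b := by
      by_contra! h
      exact hd (Perm.ext h)
    obtain ⟨b, hb⟩ := h0
    have : Nonempty {b // ρ d b ≠ b} := ⟨⟨b, hb⟩⟩
    rw [hδ, moved]
    have h1 : 0 < Nat.card {b // ρ d b ≠ b} := Nat.card_pos
    have h2 : 0 < Nat.card (Fin m) := Nat.card_pos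
    positivity
  have hδ1 : δ ≤ 1 := moved_le_one _
  refine ⟨Fin ⌈1 / δ⌉₊ → Fin m, inferInstance, inferInstance,
    piPermHom fun _ : Fin ⌈1 / δ⌉₊ => ρ, ?_, ?_⟩
  · have h := one_sub_moved_piPermHom (fun _ : Fin ⌈1 / δ⌉₊ => ρ) d
    rw [Finset.prod_const, Finset.card_univ, Fintype.card_fin, ← hδ] at h
    have h1 : (1 - δ) ^ ⌈1 / δ⌉₊ ≤ Real.exp (-1) := by
      calc (1 - δ) ^ ⌈1 / δ⌉₊ ≤ Real.exp (-δ) ^ ⌈1 / δ⌉₊ :=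
            pow_le_pow_left₀ (by linarith) (Real.one_sub_le_exp_neg δ) _
        _ = Real.exp (⌈1 / δ⌉₊ * (-δ)) := (Real.exp_nat_mul _ _).symm
        _ ≤ Real.exp (-1) := by
            apply Real.exp_le_exp.2
            have := Nat.le_ceil (1 / δ)
            rw [div_le_iff₀ hδ0] at this
            linarith
    have h2 : Real.exp (-1) ≤ 1 / 2 := by
      rw [Real.exp_neg, ← one_div]
      exact one_div_le_one_div_of_le (by norm_num) (by have := Real.exp_one_gt_d9; linarith)
    linarith
  · intro x C hC hx
    refine (moved_piPermHom_le _ x).trans ?_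
    rw [Finset.sum_const, Finset.card_univ, Fintype.card_fin, nsmul_eq_mul]
    have h1 : (⌈1 / δ⌉₊ : ℝ) ≤ 2 / δ := by
      have := Nat.ceil_lt_add_one (show 0 ≤ 1 / δ by positivity)
      have h2 : 1 ≤ 1 / δ := by rwa [le_div_iff₀ hδ0, one_mul]
      have h3 : 2 / δ = 1 / δ + 1 / δ := by ring
      linarith
    have h2 : moved (ρ x) ≤ δ / C := by rwa [le_div_iff₀' hC]
    calc (⌈1 / δ⌉₊ : ℝ) * moved (ρ x) ≤ 2 / δ * (δ / C) := by
          gcongr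
          exact moved_nonneg _
      _ = 2 / C := by field_simp

end Amplification

/-! ### Representations of locally finite quotients -/

section Representations

theorem exists_fin_rep {P : Type*} [Group P] {β : Type*} [Finite β] [Nonempty β]
    (θ : P →* Perm β) :
    ∃ m : ℕ, 1 ≤ m ∧ ∃ ρ : P →* Perm (Fin m), ∀ p, moved (ρ p) = moved (θ p) :=
  ⟨Nat.card β, Nat.card_pos,
    ((Finite.equivFin β).permCongrHom : Perm β →* Perm (Fin (Nat.card β))).comp θ,
    fun _ => moved_permCongr _ _⟩

theorem moved_toPerm {Q : Type*} [Group Q] [Finite Q] {q : Q} (hq : q ≠ 1) :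
    moved (MulAction.toPermHom Q Q q) = 1 := by
  have : IsEmpty {b // MulAction.toPermHom Q Q q b = b} :=
    ⟨fun b => hq (by simpa using b.2)⟩
  rw [moved_eq_one_sub, Nat.card_of_isEmpty]
  simp

/-- Finitely generated subgroups of a power `I → B` of a finite group are finite: two coordinates on
which all generators agree may be identified, so finitely many coordinates suffice. -/
theorem finiteIndex_subgroupOf_closure {I B P : Type*} [Group B] [Finite B] [Group P]
    (π : I → P →* B) (M : Subgroup P) (hM : ∀ p, (∀ i, π i p = 1) → p ∈ M) {F : Set P}
    (hF : F.Finite) : (M.subgroupOf (Subgroup.closure F)).FiniteIndex := by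
  have := hF.to_subtype
  let v : I → F → B := fun i f => π i f
  -- Choose one coordinate for each tuple of values of the generators.
  choose s hs using fun j : Set.range v => j.2
  let R : Subgroup.closure F →* (Set.range v → B) :=
    (MonoidHom.pi fun j => π (s j)).comp (Subgroup.closure F).subtype
  have hagree : ∀ (i : I) (p : P), p ∈ Subgroup.closure F → π i p = π (s ⟨v i, i, rfl⟩) p := by
    intro i p hp
    have hle : Subgroup.closure F ≤ (π i).eqLocus (π (s ⟨v i, i, rfl⟩)) := by
      rw [Subgroup.closure_le]
      intro f hf
      exact (congrFun (hs ⟨v i, i, rfl⟩) ⟨f, hf⟩).symm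
    exact hle hp
  have hker : R.ker ≤ M.subgroupOf (Subgroup.closure F) := by
    intro p hp
    rw [Subgroup.mem_subgroupOf]
    refine hM p fun i => ?_
    rw [hagree i p p.2]
    exact congrFun (MonoidHom.mem_ker.1 hp) _
  exact Subgroup.finiteIndex_of_le hker

theorem exists_rep_of_notMem {I B P : Type*} [Group B] [Finite B] [Group P]
    (π : I → P →* B) (M : Subgroup P) [M.Normal] (hM : ∀ p, (∀ i, π i p = 1) → p ∈ M) {F : Set P}
    (hF : F.Finite) (g : Subgroup.closure F) (hg : (g : P) ∉ M) :
    ∃ m : ℕ, 1 ≤ m ∧ ∃ ρ : Subgroup.closure F →* Perm (Fin m), moved (ρ g) = 1 ∧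
      ∀ x : Subgroup.closure F, (x : P) ∈ M → moved (ρ x) = 0 := by
  have hfi := finiteIndex_subgroupOf_closure π M hM hF
  let Q := Subgroup.closure F ⧸ M.subgroupOf (Subgroup.closure F)
  have : Finite Q := Subgroup.finite_quotient_of_finiteIndex
  obtain ⟨m, hm, ρ, hρ⟩ := exists_fin_rep
    ((MulAction.toPermHom Q Q).comp (QuotientGroup.mk' (M.subgroupOf (Subgroup.closure F))))
  refine ⟨m, hm, ρ, ?_, fun x hx => ?_⟩
  · rw [hρ, MonoidHom.comp_apply, moved_toPerm]
    rw [QuotientGroup.mk'_apply, Ne, QuotientGroup.eq_one_iff]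
    exact hg
  · have h1 : QuotientGroup.mk' (M.subgroupOf (Subgroup.closure F)) x = 1 := by
      rw [QuotientGroup.mk'_apply, QuotientGroup.eq_one_iff]
      exact hx
    rw [hρ, MonoidHom.comp_apply, h1, map_one, moved_one]

end Representations

/-! ### Quotients of products -/

theorem hammingLengths_nonempty (n : ℕ) (hn : 1 ≤ n) :
    ∃ l ∈ hammingLengths (GrpCat.of (Perm (Fin n))), ∀ σ : Perm (Fin n), l.toFun σ = moved σ :=
  ⟨{ toFun := fun σ : Perm (Fin n) => moved σ
     nonneg := moved_nonneg
     map_one := moved_one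
     map_mul_le := moved_mul_le
     map_conj := moved_conj }, ⟨n, hn, MulEquiv.refl _, fun _ => (moved_fin _).symm⟩, fun _ => rfl⟩

/-- The target of `π` does not depend on `m`; the kernel is trivial for `m ≤ 4`, and consists of
even permutations for `m ≥ 5`. -/
theorem exists_bounded_hom {H : Type*} [Group H] {m : ℕ} (ι : H →* Perm (Fin m))
    (hinj : Function.Injective ι) :
    ∃ π : H →* Perm (Fin 4) × ℤˣ, ∀ h, π h = 1 → h = 1 ∨ (5 ≤ m ∧ sign (ι h) = 1) := by
  by_cases h5 : 5 ≤ m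
  · refine ⟨MonoidHom.prod 1 (sign.comp ι), fun h hh => Or.inr ⟨h5, ?_⟩⟩
    simpa using congrArg Prod.snd hh
  · have h4 : m ≤ 4 := by omega
    refine ⟨MonoidHom.prod ((viaEmbeddingHom (Fin.castLEEmb h4)).comp ι) 1,
      fun h hh => Or.inl ?_⟩
    have h1 : viaEmbeddingHom (Fin.castLEEmb h4) (ι h) = 1 := congrArg Prod.fst hh
    exact hinj ((viaEmbeddingHom_injective _ (h1.trans (map_one _).symm)).trans
      (map_one _).symm)

section Product

variable {I : Type*} {H : I → Type*} [∀ i, Group (H i)] {m : I → ℕ}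
  (ι : ∀ i, H i →* Perm (Fin (m i))) (hinj : ∀ i, Function.Injective (ι i))
  (hrange : ∀ i, alternatingGroup (Fin (m i)) ≤ (ι i).range) (N : Subgroup (∀ i, H i)) [N.Normal]

include hinj hrange

/-- Membership in `N` can be tested coordinatewise for products of `T` conjugates of commutators
with `x ∈ N`: elements `h i` and `k i` chosen independently in all coordinates give
`k * (x * h * x⁻¹ * h⁻¹) * k⁻¹ ∈ N`. Coordinates with `d i = 1` impose no condition on `x i`. -/
theorem mem_of_forall_mem_commConj_pow {x : ∀ i, H i} (hx : x ∈ N) (T : ℕ) (d : ∀ i, H i)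
    (hd : ∀ i, d i = 1 ∨ ι i (d i) ∈ commConj (ι i (x i)) ^ T) : d ∈ N := by
  induction T generalizing d with
  | zero =>
    have : d = 1 := by
      funext i
      rcases hd i with h | h
      · exact h
      · rw [pow_zero, Set.mem_one] at h
        exact hinj i (h.trans (map_one _).symm)
    rw [this]; exact one_mem N
  | succ T ih =>
    have step : ∀ i, ∃ h k d' : H i, d i = k * (x i * h * (x i)⁻¹ * h⁻¹) * k⁻¹ * d' ∧
        (d' = 1 ∨ ι i d' ∈ commConj (ι i (x i)) ^ T) := by
      intro i
      rcases hd i with h | h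
      · exact ⟨1, 1, 1, by simp [h], Or.inl rfl⟩
      · rw [pow_succ', Set.mem_mul] at h
        obtain ⟨_, ⟨_, hh, _, hk, rfl⟩, z, hz, heq⟩ := h
        obtain ⟨h, rfl⟩ := hrange i hh
        obtain ⟨k, rfl⟩ := hrange i hk
        refine ⟨h, k, (k * (x i * h * (x i)⁻¹ * h⁻¹) * k⁻¹)⁻¹ * d i, by group, Or.inr ?_⟩
        have : ι i ((k * (x i * h * (x i)⁻¹ * h⁻¹) * k⁻¹)⁻¹ * d i) = z := by
          rw [map_mul, ← heq]
          simp only [map_mul, map_inv]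
          group
        rwa [this]
    choose h k d' h1 h2 using step
    have hdecomp : d = k * (x * (h * x⁻¹ * h⁻¹)) * k⁻¹ * d' := by
      funext i
      rw [h1 i]
      simp [mul_assoc]
    rw [hdecomp]
    refine mul_mem (Subgroup.Normal.conj_mem inferInstance _ ?_ k) (ih d' h2)
    exact mul_mem hx (Subgroup.Normal.conj_mem inferInstance _ (inv_mem hx) h)

/-- If in each nontrivial coordinate `d` is even and its support is at most `C` times as large as
that of some `x ∈ X ⊆ N`, where `x` may vary with the coordinate, then `d ∈ N`. -/
theorem mem_of_forall_support_le (C : ℕ) (X : Finset (∀ i, H i)) (hX : ∀ x ∈ X, x ∈ N)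
    (d : ∀ i, H i)
    (hd : ∀ i, d i = 1 ∨ (5 ≤ m i ∧ sign (ι i (d i)) = 1 ∧
      ∃ x ∈ X, (ι i (d i)).support.card ≤ C * (ι i (x i)).support.card)) : d ∈ N := by
  classical
  obtain ⟨T, hT⟩ := exists_uniform_commConj_pow C
  induction X using Finset.induction_on generalizing d with
  | empty =>
    have : d = 1 := by
      funext i
      rcases hd i with h | ⟨-, -, x, hx, -⟩
      · exact h
      · simp at hx
    rw [this]; exact one_mem N
  | insert x X hxX ih =>
    -- Split off the coordinates in which `x` bounds `d`.
    let J : I → Prop := fun i => (ι i (d i)).support.card ≤ C * (ι i (x i)).support.card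
    let d₁ : ∀ i, H i := fun i => if 5 ≤ m i ∧ J i then d i else 1
    let d₂ : ∀ i, H i := fun i => if 5 ≤ m i ∧ J i then 1 else d i
    have hsplit : d = d₁ * d₂ := by
      funext i
      by_cases hi : 5 ≤ m i ∧ J i <;> simp [d₁, d₂, hi]
    rw [hsplit]
    refine mul_mem ?_ (ih (fun y hy => hX y (Finset.mem_insert_of_mem hy)) d₂ fun i => ?_)
    · refine mem_of_forall_mem_commConj_pow ι hinj hrange N
        (hX x (Finset.mem_insert_self x X)) T d₁ fun i => ?_
      by_cases hi : 5 ≤ m i ∧ J i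
      · rcases hd i with h | ⟨h5, hs, -⟩
        · left; simp [d₁, h]
        · right
          simp only [d₁, hi, and_self, if_true]
          exact hT (m i) _ _ h5 hs hi.2
      · left; simp only [d₁, hi, if_false]
    · by_cases hi : 5 ≤ m i ∧ J i
      · left; simp only [d₂, hi, and_self, if_true]
      · simp only [d₂, hi, if_false]
        rcases hd i with h | ⟨h5, hs, y, hy, hle⟩
        · exact Or.inl h
        · right
          rcases Finset.mem_insert.1 hy with rfl | hy
          · exact absurd ⟨h5, hle⟩ hi
          · exact ⟨h5, hs, y, hy, hle⟩

/-- Some coordinate separates `d` from all `x ∈ X` by an arbitrarily large factor, and amplification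
in that coordinate gives the representation. -/
theorem exists_rep_of_even (hm : ∀ i, 1 ≤ m i) (X : Finset (∀ i, H i)) (hX : ∀ x ∈ X, x ∈ N)
    (d : ∀ i, H i) (hd : ∀ i, d i = 1 ∨ (5 ≤ m i ∧ sign (ι i (d i)) = 1)) (hdN : d ∉ N)
    {ε : ℝ} (hε : 0 < ε) :
    ∃ n : ℕ, 1 ≤ n ∧ ∃ ρ : (∀ i, H i) →* Perm (Fin n), 1 / 2 ≤ moved (ρ d) ∧
      ∀ x ∈ X, moved (ρ x) < ε := by
  obtain ⟨C, hC⟩ := exists_nat_gt (2 / ε)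
  have hC0 : (0 : ℝ) < C := lt_trans (by positivity) hC
  obtain ⟨i, hi1, hi2⟩ : ∃ i, d i ≠ 1 ∧
      ∀ x ∈ X, C * (ι i (x i)).support.card ≤ (ι i (d i)).support.card := by
    by_contra! hcon
    refine hdN (mem_of_forall_support_le ι hinj hrange N C X hX d fun i => ?_)
    by_cases h1 : d i = 1
    · exact Or.inl h1
    · obtain ⟨x, hx, hlt⟩ := hcon i h1
      have := (hd i).resolve_left h1
      exact Or.inr ⟨this.1, this.2, x, hx, hlt.le⟩
  obtain ⟨β, _, _, θ, hθd, hθ⟩ := exists_amplification (hm i)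
    ((ι i).comp (Pi.evalMonoidHom H i)) d
    (fun h => hi1 (hinj i (h.trans (map_one _).symm)))
  obtain ⟨n, hn, ρ, hρ⟩ := exists_fin_rep θ
  refine ⟨n, hn, ρ, by rwa [hρ], fun x hx => ?_⟩
  rw [hρ]
  refine (hθ x C hC0 ?_).trans_lt (by rwa [div_lt_comm₀ hC0 hε])
  rw [← moved_fin, ← moved_fin, hammingLength, hammingLength, ← mul_div_assoc]
  gcongr
  exact_mod_cast hi2 x hx

/-- Elements outside `N` are separated from finite subsets of `N` by permutation representations of
finitely generated subgroups. -/
theorem exists_separating_rep (hm : ∀ i, 1 ≤ m i) {F : Set (∀ i, H i)} (hF : F.Finite)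
    (X : Finset (∀ i, H i)) (hX : ∀ x ∈ X, x ∈ N) (g : Subgroup.closure F)
    (hg : (g : ∀ i, H i) ∉ N) {ε : ℝ} (hε : 0 < ε) :
    ∃ n : ℕ, 1 ≤ n ∧ ∃ ρ : Subgroup.closure F →* Perm (Fin n), 1 / 4 ≤ moved (ρ g) ∧
      ∀ x : Subgroup.closure F, (x : ∀ i, H i) ∈ X → moved (ρ x) < ε := by
  classical
  choose π hπ using fun i => exists_bounded_hom (ι i) (hinj i)
  let K : Subgroup (∀ i, H i) :=
    (MonoidHom.pi fun i => (π i).comp (Pi.evalMonoidHom H i)).ker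
  have hK : ∀ p, (∀ i, ((π i).comp (Pi.evalMonoidHom H i)) p = 1) → p ∈ N ⊔ K := fun p hp =>
    Subgroup.mem_sup_right (MonoidHom.mem_ker.2 (funext hp))
  -- If `g = n * d` with `n ∈ N` and `d ∈ K`, then making `ρ n` short keeps `ρ g` almost as long as
  -- `ρ d`.
  by_cases hgK : (g : ∀ i, H i) ∈ N ⊔ K
  · rw [← SetLike.mem_coe, Subgroup.mul_normal, Set.mem_mul] at hgK
    obtain ⟨n, hn, d, hd, hnd⟩ := hgK
    rw [SetLike.mem_coe] at hn hd
    have hdN : d ∉ N := fun h => hg (hnd ▸ mul_mem hn h)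
    obtain ⟨k, hk, ρ, hρd, hρ⟩ := exists_rep_of_even ι hinj hrange N hm (insert n X)
      (by simpa [hn] using hX) d
      (fun i => hπ i (d i) (congrFun (MonoidHom.mem_ker.1 hd) i)) hdN
      (show 0 < min ε (1 / 4) by positivity)
    refine ⟨k, hk, ρ.comp (Subgroup.closure F).subtype, ?_, fun x hx =>
      (hρ x (Finset.mem_insert_of_mem hx)).trans_le (min_le_left _ _)⟩
    have h1 := (hρ n (Finset.mem_insert_self n X)).trans_le (min_le_right _ _)
    have h2 : moved (ρ d) ≤ moved (ρ n) + moved (ρ g) := by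
      rw [← moved_inv (ρ n), show d = n⁻¹ * g by rw [← hnd]; group, map_mul, map_inv]
      exact moved_mul_le _ _
    change 1 / 4 ≤ moved (ρ g)
    linarith
  · obtain ⟨k, hk, ρ, h1, h2⟩ := exists_rep_of_notMem
      (fun i => (π i).comp (Pi.evalMonoidHom H i)) (N ⊔ K) hK hF g hgK
    exact ⟨k, hk, ρ, by rw [h1]; norm_num, fun x hx => by
      rw [h2 x (Subgroup.mem_sup_left (hX x hx))]; exact hε⟩

/-- The approximation is a lift `s` to `∏ i, H i`, followed by the product of representations that
separate the lift of each nontrivial element of `Φ` from the finitely many defects of `s` on `Φ`. -/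
theorem sofic_quotient_pi (hm : ∀ i, 1 ≤ m i) : Sofic ((∀ i, H i) ⧸ N) := by
  classical
  let s : (∀ i, H i) ⧸ N → ∀ i, H i := fun g => if g = 1 then 1 else g.out
  have hs : ∀ g, (s g : (∀ i, H i) ⧸ N) = g := by
    intro g
    by_cases h : g = 1
    · simp [s, h]
    · simp only [s, h, if_false]; exact QuotientGroup.out_eq' g
  have hs1 : s 1 = 1 := by simp [s]
  refine ⟨fun g => if g = 1 then 0 else 1 / 4, by simp, fun g hg => by simp [hg], ?_⟩
  intro Φ ε hε
  let F : Set (∀ i, H i) := s '' Φ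
  -- Outside `Φ` the lift need not lie in the subgroup generated by the lift of `Φ`; the value there
  -- is irrelevant.
  let t : (∀ i, H i) ⧸ N → Subgroup.closure F := fun g =>
    if h : s g ∈ Subgroup.closure F then ⟨s g, h⟩ else 1
  have ht : ∀ g ∈ Φ, (t g : ∀ i, H i) = s g := by
    intro g hg
    have : s g ∈ Subgroup.closure F := Subgroup.subset_closure ⟨g, hg, rfl⟩
    simp [t, this]
  have ht1 : t 1 = 1 := by
    simp only [t, hs1]
    split_ifs <;> rfl
  let X : Finset (∀ i, H i) :=
    (Φ ×ˢ Φ).image fun p => s (p.1 * p.2) * (s p.1 * s p.2)⁻¹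
  have hX : ∀ x ∈ X, x ∈ N := by
    intro x hx
    obtain ⟨p, -, rfl⟩ := Finset.mem_image.1 hx
    rw [← QuotientGroup.eq_one_iff]
    simp [hs]
  let Γ := {g // g ∈ Φ ∧ g ≠ 1}
  have : Finite Γ := (Φ.finite_toSet.subset fun g (hg : g ∈ Φ ∧ g ≠ 1) => hg.1).to_subtype
  have : Fintype Γ := Fintype.ofFinite Γ
  have hrep := fun γ : Γ => exists_separating_rep ι hinj hrange N hm
    (Φ.finite_toSet.image s) X hX (t γ) (by
      rw [ht γ γ.2.1, ← QuotientGroup.eq_one_iff, hs]; exact γ.2.2)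
    (show 0 < ε / (Fintype.card Γ + 1) by positivity)
  choose n hn ρ hρ1 hρ2 using hrep
  have : ∀ γ, Nonempty (Fin (n γ)) := fun γ => ⟨⟨0, hn γ⟩⟩
  obtain ⟨k, hk, θ, hθ⟩ := exists_fin_rep (piPermHom ρ)
  obtain ⟨l, hl, hl'⟩ := hammingLengths_nonempty k hk
  refine ⟨GrpCat.of (Perm (Fin k)), ⟨k, hk, ⟨MulEquiv.refl _⟩⟩, l, hl, fun g => θ (t g), ?_, ?_, ?_⟩
  · simp only [ht1, map_one]
  · intro g hg
    by_cases h : g = 1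
    · simp only [h, if_true]; exact l.nonneg _
    · simp only [h, if_false]
      rw [hl', hθ]
      exact (hρ1 ⟨g, hg, h⟩).trans (le_moved_piPermHom ρ (t g) ⟨g, hg, h⟩)
  · intro g hg h hh hgh
    have hθx : θ (t (g * h)) * (θ (t g) * θ (t h))⁻¹ = θ (t (g * h) * (t g * t h)⁻¹) := by simp
    have hxX : ((t (g * h) * (t g * t h)⁻¹ : Subgroup.closure F) : ∀ i, H i) ∈ X := by
      push_cast
      rw [ht _ hg, ht _ hh, ht _ hgh]
      exact Finset.mem_image.2 ⟨(g, h), Finset.mem_product.2 ⟨hg, hh⟩, rfl⟩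
    calc l.toFun (θ (t (g * h)) * (θ (t g) * θ (t h))⁻¹)
        = moved (piPermHom ρ (t (g * h) * (t g * t h)⁻¹)) := by rw [hθx, hl', hθ]
      _ ≤ ∑ γ, moved (ρ γ (t (g * h) * (t g * t h)⁻¹)) := moved_piPermHom_le ρ _
      _ ≤ ∑ _γ : Γ, ε / (Fintype.card Γ + 1) :=
          Finset.sum_le_sum fun γ _ => (hρ2 γ _ hxX).le
      _ < ε := by
          rw [Finset.sum_const, Finset.card_univ, nsmul_eq_mul, ← mul_div_assoc,
            div_lt_iff₀ (by positivity)]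
          linarith

end Product

/-! ### Sofic groups and approximation by a class of groups -/

section SoficVia

/-- `G` has sofic approximations that take values in groups of the class `K`, where the length on a
group of `K` is measured in a permutation representation. -/
def SoficVia (K : Set GrpCat.{0}) (G : Type*) [Group G] : Prop :=
  ∃ α : G → ℝ, (∀ g, g ≠ 1 → 0 < α g) ∧
    ∀ (Φ : Finset G) (ε : ℝ), 0 < ε →
      ∃ H ∈ K, ∃ (m : ℕ) (ρ : H →* Perm (Fin m)) (φ : G → H),
        φ 1 = 1 ∧
        (∀ g ∈ Φ, α g ≤ moved (ρ (φ g))) ∧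
        (∀ g ∈ Φ, ∀ h ∈ Φ, g * h ∈ Φ → moved (ρ (φ (g * h) * (φ g * φ h)⁻¹)) < ε)

variable {G : Type*} [Group G]

theorem Sofic.soficVia_sym (h : Sofic G) : SoficVia SymClass G := by
  obtain ⟨α, -, hα, h⟩ := h
  refine ⟨α, hα, fun Φ ε hε => ?_⟩
  obtain ⟨H, hH, l, ⟨m, -, e, he⟩, φ, h1, h2, h3⟩ := h Φ ε hε
  have he' : ∀ x, moved ((e : H →* Perm (Fin m)) x) = l.toFun x := fun x => by
    rw [he, moved_fin]; rfl
  exact ⟨H, hH, m, e, φ, h1, fun g hg => by rw [he']; exact h2 g hg,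
    fun g hg k hk hgk => by rw [he']; exact h3 g hg k hk hgk⟩

/-- The action on two disjoint copies of `Fin m` is by even permutations. -/
theorem exists_hom_alternatingGroup (m : ℕ) :
    ∃ D : Perm (Fin m) →* alternatingGroup (Fin (m + m)),
      ∀ σ, moved (D σ : Perm (Fin (m + m))) = moved σ := by
  let D₀ : Perm (Fin m) →* Perm (Fin (m + m)) :=
    ((finSumFinEquiv (m := m) (n := m)).permCongrHom : Perm (Fin m ⊕ Fin m) →* _).comp
      ((sumCongrHom (Fin m) (Fin m)).comp (MonoidHom.prod (MonoidHom.id _) (MonoidHom.id _)))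
  have hD : ∀ σ, D₀ σ = finSumFinEquiv.permCongr (Perm.sumCongr σ σ) := fun _ => rfl
  refine ⟨D₀.codRestrict _ fun σ => ?_, fun σ => ?_⟩
  · rw [mem_alternatingGroup, hD, sign_permCongr, sign_sumCongr, Int.units_mul_self]
  · change moved (D₀ σ) = moved σ
    rw [hD, moved_permCongr]
    have h1 : Nat.card {b // Perm.sumCongr σ σ b ≠ b} = 2 * Nat.card {b // σ b ≠ b} := by
      rw [Nat.card_congr Equiv.subtypeSum, Nat.card_sum, two_mul]
      congr 1 <;> exact Nat.card_congr (Equiv.subtypeEquivRight fun b => by simp)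
    rw [moved, moved, h1, Nat.card_sum, ← two_mul, Nat.cast_mul, Nat.cast_mul,
      mul_div_mul_left _ _ (by norm_num)]

theorem Sofic.soficVia_alt (h : Sofic G) : SoficVia AltClass G := by
  obtain ⟨α, -, hα, h⟩ := h
  refine ⟨α, hα, fun Φ ε hε => ?_⟩
  obtain ⟨H, hH, l, ⟨m, hm, e, he⟩, φ, h1, h2, h3⟩ := h Φ ε hε
  obtain ⟨D, hD⟩ := exists_hom_alternatingGroup m
  have key : ∀ x : H, moved ((alternatingGroup (Fin (m + m))).subtype (D (e x))) = l.toFun x :=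
    fun x => (hD (e x)).trans (by rw [he, moved_fin])
  refine ⟨GrpCat.of (alternatingGroup (Fin (m + m))), ⟨m + m, by omega, ⟨MulEquiv.refl _⟩⟩, m + m,
    (alternatingGroup (Fin (m + m))).subtype, fun g => D (e (φ g)), by simp only [h1, map_one],
    fun g hg => by rw [key]; exact h2 g hg, fun g hg k hk hgk => ?_⟩
  have := h3 g hg k hk hgk
  rw [← key] at this
  simpa only [map_mul, map_inv] using this

theorem moved_prod_ofFn_le {m n : ℕ} {δ : ℝ} (f : Fin n → Perm (Fin m))
    (hf : ∀ i, moved (f i) ≤ δ) : moved (List.ofFn f).prod ≤ n * δ := by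
  induction n with
  | zero => simp [moved_one]
  | succ n ih =>
    rw [List.ofFn_succ, List.prod_cons]
    refine (moved_mul_le _ _).trans ?_
    push_cast
    linarith [hf 0, ih (fun i => f i.succ) fun i => hf i.succ]

theorem SoficVia.approximable {K : Set GrpCat.{0}} (h : SoficVia K G) : Approximable K G := by
  classical
  obtain ⟨α, hα, h⟩ := h
  intro Φ n
  obtain ⟨δ, hδ, hδα⟩ : ∃ δ : ℝ, 0 < δ ∧ ∀ g ∈ Φ, g ≠ 1 → δ ≤ α g := by
    induction Φ using Finset.induction_on with
    | empty => exact ⟨1, one_pos, by simp⟩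
    | insert a s ha ih =>
      obtain ⟨δ, hδ, hs⟩ := ih
      by_cases h1 : a = 1
      · refine ⟨δ, hδ, fun g hg hg1 => ?_⟩
        rcases Finset.mem_insert.1 hg with rfl | hg
        exacts [absurd h1 hg1, hs g hg hg1]
      · refine ⟨min δ (α a), lt_min hδ (hα a h1), fun g hg hg1 => ?_⟩
        rcases Finset.mem_insert.1 hg with rfl | hg
        exacts [min_le_right _ _, (min_le_left _ _).trans (hs g hg hg1)]
  obtain ⟨H, hH, m, ρ, φ, h1, h2, h3⟩ := h Φ (δ / (n + 1)) (by positivity)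
  refine ⟨H, hH, φ, h1, ?_⟩
  rw [NSeparated, Set.eq_empty_iff_forall_notMem]
  rintro y ⟨⟨g, hg, hg1, rfl⟩, x, c, hx, hprod⟩
  have hsmall : ∀ z ∈ {x | ∃ g ∈ Φ, ∃ h ∈ Φ, g * h ∈ Φ ∧ x = φ g * φ h * (φ (g * h))⁻¹},
      moved (ρ z) ≤ δ / (n + 1) := by
    rintro _ ⟨a, ha, b, hb, hab, rfl⟩
    have := (h3 a ha b hb hab).le
    rwa [← moved_inv, ← map_inv, mul_inv_rev, inv_inv] at this
  have hx' : ∀ i, moved (ρ (x i)) ≤ δ / (n + 1) := by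
    intro i
    rcases hx i with hi | hi
    · exact hsmall _ hi
    · have := hsmall _ hi
      rwa [map_inv, moved_inv] at this
  have hle : moved (ρ (φ g)) ≤ n * (δ / (n + 1)) := by
    rw [hprod, map_list_prod, List.map_ofFn]
    refine moved_prod_ofFn_le _ fun i => ?_
    simp only [Function.comp_apply, map_mul, map_inv, moved_conj]
    exact hx' i
  have hlt : n * (δ / (n + 1)) < δ := by
    rw [← mul_div_assoc, div_lt_iff₀ (by positivity)]
    linarith
  have h4 := hδα g hg hg1
  have h5 := h2 g hg
  linarith

/-- `G` embeds in the product of the approximating groups, one for each finite `Φ ⊆ G` and each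
`ε = 1 / (n + 1)`, modulo the families whose length tends to zero along the directed set of
pairs `(Φ, n)`. -/
theorem SoficVia.subgroupOfQuotient {K : Set GrpCat.{0}} (h : SoficVia K G) :
    SubgroupOfQuotientOfProduct K (Finset G × ℕ) G := by
  classical
  obtain ⟨α, hα, h⟩ := h
  choose H hH m ρ φ h1 h2 h3 using fun i : Finset G × ℕ =>
    h i.1 (1 / ((i.2 : ℝ) + 1)) (by positivity)
  let N : Subgroup (∀ i, H i) :=
    { carrier := {p | Tendsto (fun i => moved (ρ i (p i))) atTop (𝓝 0)}
      one_mem' := by simp [moved_one]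
      mul_mem' := by
        intro a b ha hb
        refine squeeze_zero (fun i => moved_nonneg _) (fun i => ?_) (by simpa using ha.add hb)
        simp only [Pi.mul_apply, map_mul]
        exact moved_mul_le _ _
      inv_mem' := by
        intro a ha
        simpa [moved_inv] using ha }
  have hN : N.Normal := ⟨by
    intro a ha b
    change Tendsto _ _ _
    have : (fun i => moved (ρ i ((b * a * b⁻¹) i))) = fun i => moved (ρ i (a i)) := by
      funext i
      simpa using moved_conj (ρ i (a i)) (ρ i (b i))⁻¹
    rw [this]
    exact ha⟩
  have hlim : Tendsto (fun i : Finset G × ℕ => 1 / ((i.2 : ℝ) + 1)) atTop (𝓝 0) := by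
    have := tendsto_one_div_add_atTop_nhds_zero_nat (𝕜 := ℝ)
    rw [← prod_atTop_atTop_eq]
    exact this.comp tendsto_snd
  let f : G →* (∀ i, H i) ⧸ N :=
    MonoidHom.mk' (fun g => ((fun i => φ i g : ∀ i, H i) : (∀ i, H i) ⧸ N)) fun a b => by
      rw [← QuotientGroup.mk_mul, ← mul_inv_eq_one, ← QuotientGroup.mk_inv, ← QuotientGroup.mk_mul,
        QuotientGroup.eq_one_iff]
      change Tendsto _ _ _
      refine squeeze_zero' (Eventually.of_forall fun i => moved_nonneg _) ?_ hlim
      filter_upwards [eventually_ge_atTop (({a, b, a * b} : Finset G), 0)] with i hi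
      exact (h3 i a (hi.1 (by simp)) b (hi.1 (by simp)) (hi.1 (by simp))).le
  refine ⟨H, hH, N, hN, f, (injective_iff_map_eq_one f).2 fun g hg => ?_⟩
  by_contra hne
  have hg' : Tendsto (fun i => moved (ρ i (φ i g))) atTop (𝓝 0) :=
    (QuotientGroup.eq_one_iff (N := N) (fun i => φ i g : ∀ i, H i)).1 hg
  have hle : α g ≤ 0 := ge_of_tendsto hg' (by
    filter_upwards [eventually_ge_atTop (({g} : Finset G), 0)] with i hi
    exact h2 i g (hi.1 (by simp)))
  exact absurd (hα g hne) (not_lt.2 hle)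

/-- Subgroups of sofic groups are sofic. -/
theorem Sofic.of_injective {G' : Type*} [Group G'] (h : Sofic G') (f : G →* G')
    (hf : Function.Injective f) : Sofic G := by
  classical
  obtain ⟨α, h1, hα, h⟩ := h
  refine ⟨fun g => α (f g), by simp [h1], fun g hg => hα _ fun h => hg ?_, fun Φ ε hε => ?_⟩
  · exact hf (h.trans (map_one f).symm)
  obtain ⟨H, hH, l, hl, φ, h2, h3, h4⟩ := h (Φ.image f) ε hε
  refine ⟨H, hH, l, hl, fun g => φ (f g), by simpa using h2,
    fun g hg => h3 _ (Finset.mem_image_of_mem f hg), fun g hg k hk hgk => ?_⟩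
  simp only [map_mul]
  refine h4 _ (Finset.mem_image_of_mem f hg) _ (Finset.mem_image_of_mem f hk) ?_
  rw [← map_mul]
  exact Finset.mem_image_of_mem f hgk

theorem SubgroupOfQuotientOfProduct.mono {K K' : Set GrpCat.{0}} (hK : K ⊆ K') {I : Type*}
    (h : SubgroupOfQuotientOfProduct K I G) : SubgroupOfQuotientOfProduct K' I G := by
  obtain ⟨H, hH, h⟩ := h
  exact ⟨H, fun i => hK (hH i), h⟩

theorem SubgroupOfQuotientOfProduct.congr {K : Set GrpCat.{0}} {I J : Type*} (e : J ≃ I)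
    (h : SubgroupOfQuotientOfProduct K I G) : SubgroupOfQuotientOfProduct K J G := by
  obtain ⟨H, hH, N, hN, f, hf⟩ := h
  let E : (∀ i, H i) ≃* ∀ j, H (e j) :=
    { Equiv.piCongrLeft' (fun i => H i) e.symm with
      map_mul' := fun _ _ => rfl }
  have hN' : (N.map E.toMonoidHom).Normal := hN.map _ E.surjective
  refine ⟨fun j => H (e j), fun j => hH (e j), N.map E.toMonoidHom, hN',
    (QuotientGroup.congr N (N.map E.toMonoidHom) E rfl).toMonoidHom.comp f, ?_⟩
  exact (QuotientGroup.congr N (N.map E.toMonoidHom) E rfl).injective.comp hf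

end SoficVia

/-! ### Products of alternating and symmetric groups -/

/-- The groups of both classes are the subgroups of finite symmetric groups that contain the
alternating group. -/
theorem exists_hom_of_mem_classes {H : GrpCat.{0}} (hH : H ∈ AltClass ∪ SymClass) :
    ∃ (m : ℕ) (ι : H →* Perm (Fin m)), 1 ≤ m ∧ Function.Injective ι ∧
      alternatingGroup (Fin m) ≤ ι.range := by
  rcases hH with ⟨m, hm, ⟨e⟩⟩ | ⟨m, hm, ⟨e⟩⟩
  · refine ⟨m, (alternatingGroup (Fin m)).subtype.comp e.toMonoidHom, hm,
      Subtype.val_injective.comp e.injective, fun x hx => ⟨e.symm ⟨x, hx⟩, ?_⟩⟩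
    simp
  · exact ⟨m, e.toMonoidHom, hm, e.injective, fun x _ => ⟨e.symm x, by simp⟩⟩

theorem sofic_quotient_of_mem_classes {I : Type*} {H : I → GrpCat.{0}}
    (hH : ∀ i, H i ∈ AltClass ∪ SymClass) (N : Subgroup (∀ i, H i)) [N.Normal] :
    Sofic ((∀ i, H i) ⧸ N) := by
  choose m ι hm hinj hrange using fun i => exists_hom_of_mem_classes (hH i)
  exact sofic_quotient_pi ι hinj hrange N hm

theorem SubgroupOfQuotientOfProduct.sofic {G I : Type*} [Group G]
    (h : SubgroupOfQuotientOfProduct (AltClass ∪ SymClass) I G) : Sofic G := by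
  obtain ⟨H, hH, N, hN, f, hf⟩ := h
  exact (sofic_quotient_of_mem_classes hH N).of_injective f hf

theorem mainTheorem2 :
    (∀ K : Set GrpCat.{0}, K = AltClass ∨ K = SymClass →
      ∀ (I : Type v) (H : I → GrpCat.{0}), (∀ i, H i ∈ K) →
        ∀ (N : Subgroup (∀ i, H i)) [N.Normal],
          Approximable K ((∀ i, H i) ⧸ N) ∧ Sofic ((∀ i, H i) ⧸ N)) ∧
    (∀ K : Set GrpCat.{0}, K = AltClass ∨ K = SymClass ∨ K = AltClass ∪ SymClass →
      ∀ (G : Type u) [Group G],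
        (Sofic G ↔ ∃ I : Type u, SubgroupOfQuotientOfProduct K I G) ∧
        (Countable G → (Sofic G ↔ SubgroupOfQuotientOfProduct K ℕ G))) := by
  constructor
  · intro K hK I H hH N _
    have hsofic : Sofic ((∀ i, H i) ⧸ N) := by
      refine sofic_quotient_of_mem_classes (fun i => ?_) N
      rcases hK with rfl | rfl
      exacts [Or.inl (hH i), Or.inr (hH i)]
    refine ⟨?_, hsofic⟩
    rcases hK with rfl | rfl
    exacts [hsofic.soficVia_alt.approximable, hsofic.soficVia_sym.approximable]
  · intro K hK G _
    have hsub : K ⊆ AltClass ∪ SymClass := by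
      rcases hK with rfl | rfl | rfl
      exacts [Set.subset_union_left, Set.subset_union_right, le_rfl]
    have hembed : Sofic G → SubgroupOfQuotientOfProduct K (Finset G × ℕ) G := by
      intro h
      rcases hK with rfl | rfl | rfl
      exacts [h.soficVia_alt.subgroupOfQuotient, h.soficVia_sym.subgroupOfQuotient,
        h.soficVia_alt.subgroupOfQuotient.mono Set.subset_union_left]
    refine ⟨⟨fun h => ⟨_, hembed h⟩, fun ⟨I, h⟩ => (h.mono hsub).sofic⟩, fun _ =>
      ⟨fun h => ?_, fun h => (h.mono hsub).sofic⟩⟩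
    obtain ⟨e⟩ := nonempty_equiv_of_countable (α := ℕ) (β := Finset G × ℕ)
    exact (hembed h).congr e
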